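/- Call a pair $(\mathcal A,\varphi)$ a $C^*$-probability space if $\mathcal A$ is a unital $C^*$-algebra and $\varphi$ is a tracial faithful state on $\mathcal A$. A family $(x_i)_{i\in I}$ in $\mathcal A$ is free if $\varphi(a_1a_2\cdots a_n)=0$ whenever $n\ge 1$, $i_1\ne i_2\ne\cdots\ne i_n$ (neighbouring indices distinct), each $a_j$ lies in the unital $*$-subalgebra generated by $x_{i_j}$, and $\varphi(a_j)=0$ for all $j$. A semicircular system is a free family $(s_i)_{i\in I}$ of self-adjoint elements, each having as distribution the standard semicircle law, i.e. $\varphi(s_i^n)=\frac1{2\pi}\int_{-2}^{2}x^n\sqrt{4-x^2}\,dx$ for all integers $n\ge0$. A circular system is a family $(c_i)_{i\in I}$ of the form $c_i=(t_i+\sqrt{-1}\,t_i')/\sqrt2$, where the $t_i$ and $t_i'$ ($i\in I$) together form a semicircular system. Proposition. Let $(s_1,\dots,s_k)$ be a semicircular system in a $C^*$-probability space $(\mathcal A,\varphi)$, let $(c_1,\dots,c_k)$ be a circular system in a possibly different $C^*$-probability space $(\mathcal B,\psi)$, and let $A=(a_{ij})\in M_k(\mathbb C)$. Then $$\Bigl\|\sum_{i,j=1}^k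 a_{ij}\,s_is_j\Bigr\|=\Bigl\|\sum_{i,j=1}^k a_{ij}\,c_i^*c_j\Bigr\| .$$ -/

import Mathlib

open scoped ComplexOrder

namespace FreeProb

/-- `φ` is a tracial faithful state on the unital C⋆-algebra `𝒜`; the pair `(𝒜, φ)` is then called
a C⋆-probability space. -/
structure IsTracialFaithfulState {𝒜 : Type*} [CStarAlgebra 𝒜] (φ : 𝒜 →ₗ[ℂ] ℂ) : Prop where
  map_one : φ 1 = 1
  nonneg : ∀ a : 𝒜, 0 ≤ φ (star a * a)
  tracial : ∀ a b : 𝒜, φ (a * b) = φ (b * a)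
  faithful : ∀ a : 𝒜, φ (star a * a) = 0 → a = 0

/-- The family of unital ⋆-subalgebras `S i` is free with respect to `φ`: a nonempty product
`a₁ a₂ ⋯ aₙ` of centered elements `aⱼ ∈ S (iⱼ)` with `i₁ ≠ i₂`, `i₂ ≠ i₃`, …, `iₙ₋₁ ≠ iₙ` is
centered. The list `l` consists of the pairs `(iⱼ, aⱼ)`. -/
def FreeSubalgebras {𝒜 : Type*} [CStarAlgebra 𝒜] (φ : 𝒜 →ₗ[ℂ] ℂ) {ι : Type*}
    (S : ι → StarSubalgebra ℂ 𝒜) : Prop :=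
  ∀ l : List (ι × 𝒜), l ≠ [] → l.IsChain (fun p q => p.1 ≠ q.1) →
    (∀ p ∈ l, p.2 ∈ S p.1 ∧ φ p.2 = 0) → φ (l.map Prod.snd).prod = 0

/-- A family of elements is free if the unital ⋆-subalgebras generated by the single elements
are free. -/
def FreeFamily {𝒜 : Type*} [CStarAlgebra 𝒜] (φ : 𝒜 →ₗ[ℂ] ℂ) {ι : Type*} (x : ι → 𝒜) : Prop :=
  FreeSubalgebras φ (fun i => StarAlgebra.adjoin ℂ {x i})

/-- The probability measure `μ` on `ℝ` is the distribution of the (self-adjoint) element `a`: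
its moments are the moments of `a` with respect to `φ`. -/
def HasDistribution {𝒜 : Type*} [CStarAlgebra 𝒜] (φ : 𝒜 →ₗ[ℂ] ℂ) (a : 𝒜)
    (μ : MeasureTheory.Measure ℝ) : Prop :=
  MeasureTheory.IsProbabilityMeasure μ ∧
    ∀ n : ℕ, MeasureTheory.Integrable (fun x : ℝ => x ^ n) μ ∧
      φ (a ^ n) = ((∫ x : ℝ, x ^ n ∂μ : ℝ) : ℂ)

/-- The standard semicircle law `(2π)⁻¹ √(4 - x²) 1_{(-2,2)}(x) dx`. -/
noncomputable def semicircleLaw : MeasureTheory.Measure ℝ :=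
  MeasureTheory.volume.withDensity (fun x : ℝ =>
    ENNReal.ofReal
      ((Set.Ioo (-2 : ℝ) 2).indicator (fun x => 1 / (2 * Real.pi) * Real.sqrt (4 - x ^ 2)) x))

/-- A standard semicircular element. -/
def IsStandardSemicircular {𝒜 : Type*} [CStarAlgebra 𝒜] (φ : 𝒜 →ₗ[ℂ] ℂ) (s : 𝒜) : Prop :=
  IsSelfAdjoint s ∧ HasDistribution φ s semicircleLaw

/-- A semicircular system: a free family of standard semicircular elements. -/
def IsSemicircularSystem {𝒜 : Type*} [CStarAlgebra 𝒜] (φ : 𝒜 →ₗ[ℂ] ℂ) {ι : Type*}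
    (s : ι → 𝒜) : Prop :=
  FreeFamily φ s ∧ ∀ i, IsStandardSemicircular φ (s i)

/-- A circular system: `cᵢ = (tᵢ + √-1 tᵢ') / √2`, where the `tᵢ` and `tᵢ'` together
form a semicircular system. -/
def IsCircularSystem {𝒜 : Type*} [CStarAlgebra 𝒜] (φ : 𝒜 →ₗ[ℂ] ℂ) {ι : Type*}
    (c : ι → 𝒜) : Prop :=
  ∃ t t' : ι → 𝒜, IsSemicircularSystem φ (Sum.elim t t') ∧
    ∀ i, c i = ((Real.sqrt 2 : ℝ) : ℂ)⁻¹ • (t i + Complex.I • t' i)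

end FreeProb

/-! ### Moments of the semicircle law -/

namespace FreeProb

open MeasureTheory

/-! Under a faithful tracial state the norm of `X` is the growth rate of the moments of `star X * X`
(`norm_eq_of_moments_eq`), so it suffices that the families `s i * s j` and `star (c i) * c j` have
the same joint moments.

Freeness and the Catalan recursion for semicircular moments give the Schwinger–Dyson equation `τ (xᵢ
p) = (τ ⊗ τ) (∂ᵢ p)` (`VarsFree.schwingerDyson`). For linear combinations of the variables it
becomes a recursion on words: the first letter pairs with a later one, weighted by their covariance,
and splits the rest into two independent words (`splitSum_of_schwingerDyson`).

In a semicircular word of even length only pairings enclosing an even number of letters survive, as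
odd moments vanish. In an alternating word in `c⋆` and `c` these are exactly the pairings of a
starred with an unstarred letter, the only ones with nonzero circular covariance. The two recursions
therefore agree (`splitSum_semicircular_eq_circular`). -/

theorem integral_semicircleLaw (f : ℝ → ℝ) :
    ∫ x, f x ∂semicircleLaw
      = 1 / (2 * Real.pi) * ∫ x in (-2 : ℝ)..2, f x * Real.sqrt (4 - x ^ 2) := by
  have hmeas : Measurable (fun x : ℝ =>
      (Set.Ioo (-2 : ℝ) 2).indicator (fun x => 1 / (2 * Real.pi) * Real.sqrt (4 - x ^ 2)) x) :=
    Measurable.indicator (by fun_prop) measurableSet_Ioo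
  rw [semicircleLaw, integral_withDensity_eq_integral_toReal_smul hmeas.ennreal_ofReal
    (by simp)]
  rw [intervalIntegral.integral_of_le (by norm_num), integral_Ioc_eq_integral_Ioo,
    ← integral_const_mul, ← integral_indicator measurableSet_Ioo]
  refine integral_congr_ae (Filter.Eventually.of_forall fun x => ?_)
  by_cases hx : x ∈ Set.Ioo (-2 : ℝ) 2
  · simp only [hx, Set.indicator_of_mem, smul_eq_mul]
    rw [ENNReal.toReal_ofReal (by positivity)]
    ring
  · simp [hx]

/-- The function `x ^ m * (4 - x ^ 2) ^ (3/2)` vanishes at both endpoints, so its derivative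
integrates to zero. The truncated exponent at `m = 0` is harmless because of the factor `m`. -/
theorem semicircle_integral_by_parts (m : ℕ) :
    (m : ℝ) * (4 * (∫ x in (-2 : ℝ)..2, x ^ (m - 1) * Real.sqrt (4 - x ^ 2)) -
        ∫ x in (-2 : ℝ)..2, x ^ (m + 1) * Real.sqrt (4 - x ^ 2))
      = 3 * ∫ x in (-2 : ℝ)..2, x ^ (m + 1) * Real.sqrt (4 - x ^ 2) := by
  have hi : ∀ n : ℕ, IntervalIntegrable (fun x : ℝ => x ^ n * Real.sqrt (4 - x ^ 2))
      volume (-2) 2 := fun n => Continuous.intervalIntegrable (by fun_prop) _ _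
  have key := intervalIntegral.integral_eq_sub_of_hasDerivAt_of_le (a := (-2 : ℝ)) (b := 2)
    (f := fun x : ℝ => x ^ m * ((4 - x ^ 2) * Real.sqrt (4 - x ^ 2)))
    (f' := fun x : ℝ => (m : ℝ) * (4 * (x ^ (m - 1) * Real.sqrt (4 - x ^ 2)) -
      x ^ (m + 1) * Real.sqrt (4 - x ^ 2)) - 3 * (x ^ (m + 1) * Real.sqrt (4 - x ^ 2)))
    (by norm_num) (by fun_prop) (fun x hx => ?_)
    ((((hi _).const_mul 4).sub (hi _)).const_mul _ |>.sub ((hi _).const_mul 3))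
  · rw [intervalIntegral.integral_sub ((((hi _).const_mul 4).sub (hi _)).const_mul _)
      ((hi _).const_mul 3), intervalIntegral.integral_const_mul,
      intervalIntegral.integral_sub ((hi _).const_mul 4) (hi _),
      intervalIntegral.integral_const_mul, intervalIntegral.integral_const_mul] at key
    norm_num at key
    linarith
  · have hpos : 0 < 4 - x ^ 2 := by nlinarith [hx.1, hx.2]
    have h1 : HasDerivAt (fun x : ℝ => 4 - x ^ 2) (-(2 * x)) x := by
      simpa using (hasDerivAt_pow 2 x).const_sub 4
    have h2 := (hasDerivAt_pow m x).mul (h1.mul (h1.sqrt hpos.ne'))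
    refine h2.congr_deriv ?_
    have hs : Real.sqrt (4 - x ^ 2) * Real.sqrt (4 - x ^ 2) = 4 - x ^ 2 :=
      Real.mul_self_sqrt hpos.le
    have hs0 : Real.sqrt (4 - x ^ 2) ≠ 0 := (Real.sqrt_pos.2 hpos).ne'
    have h3 : (4 - x ^ 2) * (-(2 * x) / (2 * Real.sqrt (4 - x ^ 2)))
        = - x * Real.sqrt (4 - x ^ 2) := by
      field_simp
      rw [sq (Real.sqrt _), hs]
    simp only [Pi.mul_apply]
    rw [h3]
    rcases m with _ | m
    · simp; ring
    · simp only [Nat.add_sub_cancel]; push_cast; ring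

theorem semicircleLaw_moment_recursion (m : ℕ) :
    ((m : ℝ) + 3) * ∫ x, x ^ (m + 1) ∂semicircleLaw
      = 4 * m * ∫ x, x ^ (m - 1) ∂semicircleLaw := by
  have h := semicircle_integral_by_parts m
  rw [integral_semicircleLaw, integral_semicircleLaw]
  linear_combination (-1 / (2 * Real.pi)) * h

theorem semicircleLaw_odd_moment (k : ℕ) : ∫ x, x ^ (2 * k + 1) ∂semicircleLaw = 0 := by
  induction k with
  | zero =>
    have h := semicircleLaw_moment_recursion 0
    simpa using h
  | succ k ih =>
    have h := semicircleLaw_moment_recursion (2 * k + 2)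
    rw [show 2 * k + 2 - 1 = 2 * k + 1 by omega, ih, mul_zero] at h
    exact (mul_eq_zero.1 h).resolve_left (by positivity)

theorem succ_succ_mul_catalan_succ (n : ℕ) :
    ((n : ℝ) + 2) * catalan (n + 1) = 2 * (2 * n + 1) * catalan n := by
  have h1 := succ_mul_catalan_eq_centralBinom n
  have h2 := succ_mul_catalan_eq_centralBinom (n + 1)
  have h3 := Nat.succ_mul_centralBinom_succ n
  rw [← h1, ← h2] at h3
  have h4 : ((n : ℝ) + 1) * (((n : ℝ) + 2) * catalan (n + 1))
      = (n + 1) * (2 * (2 * n + 1) * catalan n) := by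
    have : (((n + 1) * ((n + 1 + 1) * catalan (n + 1)) : ℕ) : ℝ)
      = ((2 * (2 * n + 1) * ((n + 1) * catalan n) : ℕ) : ℝ) := by exact_mod_cast h3
    push_cast at this
    linear_combination this
  exact mul_left_cancel₀ (by positivity) h4

/-- The total mass is never computed: `HasDistribution` supplies the normalisation `hp`, which
settles `k = 0`. -/
theorem semicircleLaw_even_moment (hp : IsProbabilityMeasure semicircleLaw) (k : ℕ) :
    ∫ x, x ^ (2 * k) ∂semicircleLaw = catalan k := by
  induction k with
  | zero => simp
  | succ k ih =>
    have h := semicircleLaw_moment_recursion (2 * k + 1)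
    rw [show 2 * k + 1 - 1 = 2 * k by omega, ih] at h
    have h2 := succ_succ_mul_catalan_succ k
    push_cast at h
    refine mul_left_cancel₀ (a := (2 * (k : ℝ) + 1 + 3)) (by positivity) ?_
    rw [show 2 * (k + 1) = 2 * k + 1 + 1 by ring, h]
    linear_combination (-2) * h2

/-- This is Segner's recursion for Catalan numbers, padded by vanishing odd moments into the
one-variable Schwinger–Dyson equation. -/
theorem semicircleLaw_moment_succ (hp : IsProbabilityMeasure semicircleLaw) (n : ℕ) :
    ∫ x, x ^ (n + 1) ∂semicircleLaw = ∑ k ∈ Finset.range n,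
      (∫ x, x ^ k ∂semicircleLaw) * ∫ x, x ^ (n - 1 - k) ∂semicircleLaw := by
  obtain ⟨m, rfl | rfl⟩ := Nat.even_or_odd' n
  · rw [semicircleLaw_odd_moment]
    symm
    refine Finset.sum_eq_zero fun k hk => ?_
    rw [Finset.mem_range] at hk
    obtain ⟨l, rfl | rfl⟩ := Nat.even_or_odd' k
    · rw [show 2 * m - 1 - 2 * l = 2 * (m - 1 - l) + 1 by omega, semicircleLaw_odd_moment,
        mul_zero]
    · rw [semicircleLaw_odd_moment, zero_mul]
  · rw [show 2 * m + 1 + 1 = 2 * (m + 1) by ring, semicircleLaw_even_moment hp, catalan_succ']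
    have hpair : ∀ (g : ℕ → ℝ) (N : ℕ), (∀ k, g (2 * k + 1) = 0) →
        ∑ k ∈ Finset.range (2 * N + 1), g k = ∑ k ∈ Finset.range (N + 1), g (2 * k) := by
      intro g N hg
      induction N with
      | zero => simp
      | succ N ih =>
        rw [show 2 * (N + 1) + 1 = 2 * N + 1 + 1 + 1 by ring, Finset.sum_range_succ,
          Finset.sum_range_succ, ih, Finset.sum_range_succ _ (N + 1), hg, add_zero]
        ring_nf
    rw [hpair _ m (fun k => by rw [semicircleLaw_odd_moment, zero_mul]),
      Finset.Nat.sum_antidiagonal_eq_sum_range_succ (fun a b => catalan a * catalan b)]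
    push_cast
    refine Finset.sum_congr rfl fun k hk => ?_
    rw [Finset.mem_range] at hk
    rw [semicircleLaw_even_moment hp, show 2 * m - 2 * k = 2 * (m - k) by omega,
      semicircleLaw_even_moment hp]

end FreeProb

/-! ### The norm as growth rate of moments -/

namespace FreeProb

section Norm

variable {𝒜 ℬ : Type*} [CStarAlgebra 𝒜] [CStarAlgebra ℬ]

theorem IsTracialFaithfulState.nontrivial {φ : 𝒜 →ₗ[ℂ] ℂ} (hφ : IsTracialFaithfulState φ) :
    Nontrivial 𝒜 := by
  refine ⟨1, 0, fun h => ?_⟩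
  have := hφ.map_one
  rw [h, map_zero] at this
  exact zero_ne_one this

theorem IsTracialFaithfulState.map_pow_le {ψ : ℬ →ₗ[ℂ] ℂ} (hψ : IsTracialFaithfulState ψ)
    (Y : ℬ) (n : ℕ) : ψ ((star Y * Y) ^ n) ≤ ((‖star Y * Y‖ ^ n : ℝ) : ℂ) := by
  let _ := CStarAlgebra.spectralOrder ℬ
  let _ := CStarAlgebra.spectralOrderedRing ℬ
  have := hψ.nontrivial
  have hK : IsSelfAdjoint (star Y * Y) := .star_mul_self Y
  have h1 : (star Y * Y) ^ n ≤ algebraMap ℝ ℬ (‖star Y * Y‖ ^ n) :=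
    ((hK.pow n).le_algebraMap_norm_self).trans (algebraMap_mono ℬ (norm_pow_le _ n))
  obtain ⟨z, hz⟩ := CStarAlgebra.nonneg_iff_eq_star_mul_self.1 (sub_nonneg.2 h1)
  have h2 := hψ.nonneg z
  rw [← hz, map_sub, sub_nonneg, Algebra.algebraMap_eq_smul_one] at h2
  rwa [← Complex.coe_smul, map_smul, hψ.map_one, smul_eq_mul, mul_one] at h2

/-- The moments of `X⋆ X` grow at least as fast as `rⁿ` for every `r < ‖X⋆ X‖`. -/
theorem IsTracialFaithfulState.exists_le_map_pow {φ : 𝒜 →ₗ[ℂ] ℂ}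
    (hφ : IsTracialFaithfulState φ) (X : 𝒜) {r : ℝ} (hr : 0 < r) (hrX : r < ‖star X * X‖) :
    ∃ c : ℝ, 0 < c ∧ ∀ n : ℕ, ((c * r ^ n : ℝ) : ℂ) ≤ φ ((star X * X) ^ n) := by
  let _ := CStarAlgebra.spectralOrder 𝒜
  let _ := CStarAlgebra.spectralOrderedRing 𝒜
  have := hφ.nontrivial
  set H : 𝒜 := star X * X with hH
  set R : ℝ := ‖H‖
  have hH0 : 0 ≤ H := star_mul_self_nonneg X
  have hHs : IsSelfAdjoint H := .star_mul_self X
  have hR : R ∈ spectrum ℝ H := CStarAlgebra.norm_mem_spectrum_of_nonneg hH0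
  -- The cutoff vanishes up to `r` but is positive at `R`, a point of the spectrum. Hence `G ≠ 0`,
  -- and faithfulness bounds `φ (star G * G)` away from zero.
  let g : ℝ → ℝ := fun x => max (x - r) 0
  have hg : Continuous g := by fun_prop
  set G : 𝒜 := cfc g H with hG
  have hGs : IsSelfAdjoint G := cfc_predicate g H
  have hG0 : G ≠ 0 := by
    intro h0
    have hmem : g R ∈ spectrum ℝ G := by
      rw [hG, cfc_map_spectrum g H hHs hg.continuousOn]
      exact ⟨R, hR, rfl⟩
    rw [h0, spectrum.zero_eq, Set.mem_singleton_iff] at hmem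
    have : 0 < g R := lt_max_of_lt_left (sub_pos.2 hrX)
    linarith
  have hpos : 0 < φ (star G * G) :=
    lt_of_le_of_ne (hφ.nonneg G) fun h => hG0 (hφ.faithful G h.symm)
  obtain ⟨d, hd⟩ : ∃ d : ℝ, φ (star G * G) = d :=
    ⟨(φ (star G * G)).re, by
      have := (Complex.nonneg_iff.1 hpos.le).2
      apply Complex.ext <;> simp [← this]⟩
  rw [hd] at hpos
  have hd0 : 0 < d := by exact_mod_cast hpos
  have hRpos : 0 < R := hr.trans hrX
  refine ⟨d / R ^ 2, by positivity, fun n => ?_⟩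
  -- On the spectrum `g ^ 2 ≤ R ^ 2`, and `r ^ n ≤ x ^ n` wherever `g x ≠ 0`.
  have hle : algebraMap ℝ 𝒜 (r ^ n / R ^ 2) * (star G * G) ≤ H ^ n := by
    have e1 : algebraMap ℝ 𝒜 (r ^ n / R ^ 2) * (star G * G)
        = cfc (fun x => (r ^ n / R ^ 2) * (g x * g x)) H := by
      rw [hGs.star_eq, cfc_const_mul _ _ H, cfc_mul g g H, ← Algebra.smul_def]
    rw [e1, ← cfc_pow_id (R := ℝ) H n]
    refine cfc_mono fun x hx => ?_
    have hx0 : 0 ≤ x := spectrum_nonneg_of_nonneg hH0 hx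
    have hxR : x ≤ R := (le_abs_self x).trans (spectrum.norm_le_norm_of_mem hx)
    rcases le_total x r with hxr | hxr
    · have : g x = 0 := max_eq_right (sub_nonpos.2 hxr)
      rw [this]
      simp only [mul_zero]
      positivity
    · have : g x = x - r := max_eq_left (sub_nonneg.2 hxr)
      rw [this, div_mul_eq_mul_div, div_le_iff₀ (by positivity)]
      exact mul_le_mul (pow_le_pow_left₀ hr.le hxr n) (by nlinarith)
        (mul_self_nonneg _) (by positivity)
  obtain ⟨z, hz⟩ := CStarAlgebra.nonneg_iff_eq_star_mul_self.1 (sub_nonneg.2 hle)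
  have h2 := hφ.nonneg z
  rw [← hz, map_sub, sub_nonneg, ← Algebra.smul_def, ← Complex.coe_smul, map_smul, hd,
    smul_eq_mul] at h2
  refine le_trans (le_of_eq ?_) h2
  push_cast
  ring

/-- For `r` strictly between the norms of `star Y * Y` and `star X * X`, the common moments would be
at least `c * r ^ n` and at most `‖star Y * Y‖ ^ n`, which fails for large `n`. -/
theorem norm_le_of_moments_eq {φ : 𝒜 →ₗ[ℂ] ℂ} (hφ : IsTracialFaithfulState φ)
    {ψ : ℬ →ₗ[ℂ] ℂ} (hψ : IsTracialFaithfulState ψ) (X : 𝒜) (Y : ℬ)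
    (h : ∀ n : ℕ, φ ((star X * X) ^ n) = ψ ((star Y * Y) ^ n)) : ‖X‖ ≤ ‖Y‖ := by
  by_contra! hlt
  have hlt' : ‖star Y * Y‖ < ‖star X * X‖ := by
    rw [CStarRing.norm_star_mul_self, CStarRing.norm_star_mul_self]
    exact mul_self_lt_mul_self (norm_nonneg Y) hlt
  obtain ⟨r, hr1, hr2⟩ := exists_between hlt'
  have hr : 0 < r := (norm_nonneg _).trans_lt hr1
  obtain ⟨c, hc, hcr⟩ := hφ.exists_le_map_pow X hr hr2
  have hbound : ∀ n : ℕ, c ≤ (‖star Y * Y‖ / r) ^ n := fun n => by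
    have h1 := (hcr n).trans ((h n).le.trans (hψ.map_pow_le Y n))
    have h2 : c * r ^ n ≤ ‖star Y * Y‖ ^ n := by exact_mod_cast h1
    rwa [div_pow, le_div_iff₀ (by positivity)]
  obtain ⟨n, hn⟩ := exists_pow_lt_of_lt_one hc ((div_lt_one hr).2 hr1)
  exact absurd (hbound n) hn.not_ge

theorem norm_eq_of_moments_eq {φ : 𝒜 →ₗ[ℂ] ℂ} (hφ : IsTracialFaithfulState φ)
    {ψ : ℬ →ₗ[ℂ] ℂ} (hψ : IsTracialFaithfulState ψ) (X : 𝒜) (Y : ℬ)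
    (h : ∀ n : ℕ, φ ((star X * X) ^ n) = ψ ((star Y * Y) ^ n)) : ‖X‖ = ‖Y‖ :=
  (norm_le_of_moments_eq hφ hψ X Y h).antisymm
    (norm_le_of_moments_eq hψ hφ Y X fun n => (h n).symm)

end Norm

end FreeProb

/-! ### Free difference quotients -/

namespace FreeProb

open scoped TensorProduct

section DifferenceQuotient

variable {ι : Type*}

/-- The elements `q` with `q N ⊆ N` form a subalgebra containing the generators, so `N` is a left
ideal containing `1`. -/
theorem freeAlgebra_submodule_eq_top (N : Submodule ℂ (FreeAlgebra ℂ ι)) (h1 : 1 ∈ N)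
    (hmul : ∀ i, ∀ p ∈ N, FreeAlgebra.ι ℂ i * p ∈ N) : N = ⊤ := by
  have h : ∀ q : FreeAlgebra ℂ ι, ∀ p ∈ N, q * p ∈ N := by
    intro q
    induction q using FreeAlgebra.induction with
    | grade0 r => intro p hp; rw [← Algebra.smul_def]; exact N.smul_mem r hp
    | grade1 i => exact hmul i
    | mul a b ha hb => intro p hp; rw [mul_assoc]; exact ha _ (hb _ hp)
    | add a b ha hb => intro p hp; rw [add_mul]; exact N.add_mem (ha _ hp) (hb _ hp)
  exact (Submodule.eq_top_iff').2 fun q => by simpa using h q 1 h1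

variable [DecidableEq ι]

/-- The homomorphism `p ↦ !![p ⊗ 1, ∂ᵢ p; 0, 1 ⊗ p]`, where `∂ᵢ` is the free difference
quotient. -/
noncomputable def differenceQuotientHom (i : ι) : FreeAlgebra ℂ ι →ₐ[ℂ]
    Matrix (Fin 2) (Fin 2) (FreeAlgebra ℂ ι ⊗[ℂ] FreeAlgebra ℂ ι) :=
  FreeAlgebra.lift ℂ fun j =>
    !![FreeAlgebra.ι ℂ j ⊗ₜ 1, if i = j then 1 else 0; 0, 1 ⊗ₜ FreeAlgebra.ι ℂ j]

/-- The free difference quotient `∂ᵢ`, which satisfies `∂ᵢ xⱼ = δᵢⱼ 1 ⊗ 1` and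
`∂ᵢ (p q) = ∂ᵢ p (1 ⊗ q) + (p ⊗ 1) ∂ᵢ q`. -/
noncomputable def differenceQuotient (i : ι) :
    FreeAlgebra ℂ ι →ₗ[ℂ] FreeAlgebra ℂ ι ⊗[ℂ] FreeAlgebra ℂ ι :=
  Matrix.entryLinearMap ℂ _ 0 1 ∘ₗ (differenceQuotientHom i).toLinearMap

theorem differenceQuotientHom_apply (i : ι) (p : FreeAlgebra ℂ ι) :
    differenceQuotientHom i p = !![p ⊗ₜ 1, differenceQuotient i p; 0, 1 ⊗ₜ p] := by
  suffices h : differenceQuotientHom i p 0 0 = p ⊗ₜ 1 ∧ differenceQuotientHom i p 1 0 = 0 ∧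
      differenceQuotientHom i p 1 1 = 1 ⊗ₜ p by
    ext a b
    fin_cases a <;> fin_cases b
    · exact h.1
    · rfl
    · exact h.2.1
    · exact h.2.2
  induction p using FreeAlgebra.induction with
  | grade0 r =>
    simp [Algebra.algebraMap_eq_smul_one, Algebra.TensorProduct.one_def, TensorProduct.smul_tmul']
  | grade1 j => simp [differenceQuotientHom]
  | mul a b ha hb =>
    simp [Matrix.mul_apply, Fin.sum_univ_two, ha, hb]
  | add a b ha hb =>
    simp [ha, hb, TensorProduct.add_tmul, TensorProduct.tmul_add]

theorem differenceQuotient_mul (i : ι) (p q : FreeAlgebra ℂ ι) :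
    differenceQuotient i (p * q)
      = differenceQuotient i p * (1 ⊗ₜ q) + (p ⊗ₜ 1) * differenceQuotient i q := by
  have h : differenceQuotientHom i (p * q) 0 1
      = (differenceQuotientHom i p * differenceQuotientHom i q) 0 1 := by rw [map_mul]
  rw [differenceQuotientHom_apply, differenceQuotientHom_apply, differenceQuotientHom_apply,
    Matrix.mul_apply, Fin.sum_univ_two] at h
  simpa [add_comm] using h

theorem differenceQuotient_one (i : ι) : differenceQuotient i 1 = 0 := by
  simp [differenceQuotient]

theorem differenceQuotient_ι (i j : ι) :
    differenceQuotient i (FreeAlgebra.ι ℂ j) = if i = j then 1 else 0 := by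
  simp [differenceQuotient, differenceQuotientHom]

theorem differenceQuotient_ι_pow (i j : ι) (n : ℕ) :
    differenceQuotient i (FreeAlgebra.ι ℂ j ^ n) = if i = j then
      ∑ k ∈ Finset.range n, (FreeAlgebra.ι ℂ j ^ k) ⊗ₜ (FreeAlgebra.ι ℂ j ^ (n - 1 - k))
      else 0 := by
  induction n with
  | zero => simp [differenceQuotient_one]
  | succ n ih =>
    rw [pow_succ, differenceQuotient_mul, ih, differenceQuotient_ι]
    split_ifs with h
    · rw [Finset.sum_range_succ, Finset.sum_mul]
      congr 1
      · refine Finset.sum_congr rfl fun k hk => ?_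
        rw [Finset.mem_range] at hk
        rw [Algebra.TensorProduct.tmul_mul_tmul, mul_one, ← pow_succ]
        congr 2
        omega
      · simp
    · simp

end DifferenceQuotient

/-! ### The Schwinger–Dyson equation from freeness -/

section SchwingerDyson

variable {ι : Type*} (τ : FreeAlgebra ℂ ι →ₗ[ℂ] ℂ)

/-- The functional `τ ⊗ τ`. -/
noncomputable def tensorSquare : FreeAlgebra ℂ ι ⊗[ℂ] FreeAlgebra ℂ ι →ₗ[ℂ] ℂ :=
  LinearMap.mul' ℂ ℂ ∘ₗ TensorProduct.map τ τ

theorem tensorSquare_tmul (p q : FreeAlgebra ℂ ι) : tensorSquare τ (p ⊗ₜ q) = τ p * τ q := by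
  simp [tensorSquare]

/-- The element `p (xᵢ)` of the free algebra. -/
noncomputable def evalVar (i : ι) : Polynomial ℂ →ₐ[ℂ] FreeAlgebra ℂ ι :=
  Polynomial.aeval (FreeAlgebra.ι ℂ i)

/-- The product of the `p (xᵢ)` over a list of pairs `(i, p)`. -/
noncomputable def blockProd (l : List (ι × Polynomial ℂ)) : FreeAlgebra ℂ ι :=
  (l.map fun a => evalVar a.1 a.2).prod

/-- Neighbouring factors use different variables and each factor is centered. -/
def IsAlternatingCentered (l : List (ι × Polynomial ℂ)) : Prop :=
  l.IsChain (fun a b => a.1 ≠ b.1) ∧ ∀ a ∈ l, τ (evalVar a.1 a.2) = 0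

/-- The variables are free with respect to `τ`. -/
def VarsFree : Prop :=
  ∀ l : List (ι × Polynomial ℂ), l ≠ [] → IsAlternatingCentered τ l → τ (blockProd l) = 0

variable {τ}

@[simp] theorem blockProd_nil : blockProd ([] : List (ι × Polynomial ℂ)) = 1 := by
  simp [blockProd]

@[simp] theorem blockProd_cons (a : ι × Polynomial ℂ) (l : List (ι × Polynomial ℂ)) :
    blockProd (a :: l) = evalVar a.1 a.2 * blockProd l := by
  simp [blockProd]

@[simp] theorem blockProd_append (l l' : List (ι × Polynomial ℂ)) :
    blockProd (l ++ l') = blockProd l * blockProd l' := by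
  simp [blockProd]

theorem evalVar_center (h1 : τ 1 = 1) (i : ι) (p : Polynomial ℂ) :
    τ (evalVar i (p - Polynomial.C (τ (evalVar i p)))) = 0 := by
  simp [evalVar, Algebra.algebraMap_eq_smul_one, h1]

theorem evalVar_center_add (i : ι) (p : Polynomial ℂ) (c : ℂ) :
    evalVar i p = evalVar i (p - Polynomial.C c) + c • 1 := by
  simp [evalVar, Algebra.algebraMap_eq_smul_one]

theorem IsAlternatingCentered.tail {a : ι × Polynomial ℂ} {l : List (ι × Polynomial ℂ)}
    (h : IsAlternatingCentered τ (a :: l)) : IsAlternatingCentered τ l :=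
  ⟨h.1.tail, fun b hb => h.2 b (List.mem_cons_of_mem _ hb)⟩

theorem IsAlternatingCentered.cons {a : ι × Polynomial ℂ} {l : List (ι × Polynomial ℂ)}
    (h : IsAlternatingCentered τ l) (ha : τ (evalVar a.1 a.2) = 0)
    (hl : ∀ b ∈ l.head?, a.1 ≠ b.1) : IsAlternatingCentered τ (a :: l) :=
  ⟨List.isChain_cons.2 ⟨hl, h.1⟩, by
    intro b hb
    rcases List.mem_cons.1 hb with rfl | hb
    exacts [ha, h.2 b hb]⟩

theorem IsAlternatingCentered.head_ne {a : ι × Polynomial ℂ} {l : List (ι × Polynomial ℂ)}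
    (h : IsAlternatingCentered τ (a :: l)) : ∀ b ∈ l.head?, a.1 ≠ b.1 :=
  (List.isChain_cons.1 h.1).1

theorem IsAlternatingCentered.snoc {a : ι × Polynomial ℂ} {l : List (ι × Polynomial ℂ)}
    (h : IsAlternatingCentered τ l) (ha : τ (evalVar a.1 a.2) = 0)
    (hl : ∀ b ∈ l.getLast?, b.1 ≠ a.1) : IsAlternatingCentered τ (l ++ [a]) := by
  refine ⟨List.isChain_append.2 ⟨h.1, List.isChain_singleton _, ?_⟩, ?_⟩
  · intro x hx y hy
    simp only [List.head?_cons, Option.mem_def, Option.some.injEq] at hy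
    subst hy
    exact hl x hx
  · intro b hb
    rcases List.mem_append.1 hb with hb | hb
    · exact h.2 b hb
    · rw [List.mem_singleton.1 hb]; exact ha

/-- Here `p` need not be centered: its centered part extends the alternating product, and its
constant part leaves `l`, which is nonempty. -/
theorem VarsFree.map_mul_blockProd (hf : VarsFree τ) (h1 : τ 1 = 1) {i : ι}
    {l : List (ι × Polynomial ℂ)} (h : IsAlternatingCentered τ l) (hne : l ≠ [])
    (hl : ∀ b ∈ l.head?, i ≠ b.1) (p : Polynomial ℂ) : τ (evalVar i p * blockProd l) = 0 := by
  rw [evalVar_center_add i p (τ (evalVar i p)), add_mul, map_add, smul_mul_assoc, one_mul,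
    map_smul, hf l hne h, smul_zero, add_zero, ← blockProd_cons (i, _)]
  exact hf _ (by simp) (h.cons (evalVar_center h1 i p) hl)

theorem VarsFree.map_blockProd_mul (hf : VarsFree τ) (h1 : τ 1 = 1) {i : ι}
    {l : List (ι × Polynomial ℂ)} (h : IsAlternatingCentered τ l) (hne : l ≠ [])
    (hl : ∀ b ∈ l.getLast?, b.1 ≠ i) (p : Polynomial ℂ) : τ (blockProd l * evalVar i p) = 0 := by
  rw [evalVar_center_add i p (τ (evalVar i p)), mul_add, map_add, mul_smul_comm, mul_one,
    map_smul, hf l hne h, smul_zero, add_zero]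
  have := hf (l ++ [(i, p - Polynomial.C (τ (evalVar i p)))]) (by simp)
    (h.snoc (evalVar_center h1 i p) hl)
  simpa using this

/-- A letter multiplied from the left either starts a new block or merges with the first one;
recentering a merged block leaves alternating products only. -/
theorem span_blockProd_eq_top (h1 : τ 1 = 1) (h0 : ∀ i, τ (FreeAlgebra.ι ℂ i) = 0) :
    Submodule.span ℂ {p | ∃ l, IsAlternatingCentered τ l ∧ blockProd l = p} = ⊤ := by
  refine freeAlgebra_submodule_eq_top _ (Submodule.subset_span ⟨[], ⟨by simp, by simp⟩, by simp⟩)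
    fun i p hp => ?_
  induction hp using Submodule.span_induction with
  | zero => simp
  | add x y _ _ hx hy => rw [mul_add]; exact Submodule.add_mem _ hx hy
  | smul c x _ hx => rw [mul_smul_comm]; exact Submodule.smul_mem _ _ hx
  | mem x hx =>
    obtain ⟨l, hl, rfl⟩ := hx
    have hX : FreeAlgebra.ι ℂ i = evalVar i Polynomial.X := by simp [evalVar]
    by_cases hh : ∀ b ∈ l.head?, i ≠ b.1
    · refine Submodule.subset_span ⟨(i, Polynomial.X) :: l, hl.cons ?_ hh, ?_⟩
      · simp [evalVar, h0]
      · simp [hX]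
    · push Not at hh
      obtain ⟨⟨j, q⟩, hb, rfl⟩ := hh
      obtain ⟨t, rfl⟩ : ∃ t, l = (i, q) :: t := by
        cases l with
        | nil => simp at hb
        | cons a t => simp at hb; exact ⟨t, by rw [hb]⟩
      rw [hX, blockProd_cons, ← mul_assoc, ← map_mul,
        evalVar_center_add i (Polynomial.X * q) (τ (evalVar i (Polynomial.X * q))), add_mul,
        smul_mul_assoc, one_mul]
      exact Submodule.add_mem _ (Submodule.subset_span
        ⟨(i, Polynomial.X * q - Polynomial.C (τ (evalVar i (Polynomial.X * q)))) :: t,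
          hl.tail.cons (evalVar_center h1 i _) hl.head_ne, blockProd_cons _ _⟩)
        (Submodule.smul_mem _ _ (Submodule.subset_span ⟨t, hl.tail, rfl⟩))

variable [DecidableEq ι]

theorem differenceQuotient_evalVar_of_ne {i j : ι} (hij : i ≠ j) (p : Polynomial ℂ) :
    differenceQuotient i (evalVar j p) = 0 := by
  induction p using Polynomial.induction_on' with
  | add p q hp hq => rw [map_add, map_add, hp, hq, add_zero]
  | monomial n c =>
    rw [← Polynomial.smul_X_eq_monomial]
    simp [evalVar, differenceQuotient_ι_pow, hij]

theorem differenceQuotient_evalVar_mem (i : ι) (p : Polynomial ℂ) :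
    differenceQuotient i (evalVar i p)
      ∈ Submodule.span ℂ {z | ∃ q r, z = evalVar i q ⊗ₜ[ℂ] evalVar i r} := by
  induction p using Polynomial.induction_on' with
  | add p q hp hq => rw [map_add, map_add]; exact Submodule.add_mem _ hp hq
  | monomial n c =>
    rw [← Polynomial.smul_X_eq_monomial, map_smul, map_smul]
    refine Submodule.smul_mem _ _ ?_
    rw [map_pow, evalVar, Polynomial.aeval_X, differenceQuotient_ι_pow, if_pos rfl]
    exact Submodule.sum_mem _ fun k _ => Submodule.subset_span
      ⟨Polynomial.X ^ k, Polynomial.X ^ (n - 1 - k), by simp⟩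

/-- The expression is a combination of products `τ (u * q(xᵢ)) * τ (r(xᵢ) * v)`, and one of the two
factors always vanishes. -/
theorem tensorSquare_sandwich_differenceQuotient {i j : ι} {u v : FreeAlgebra ℂ ι}
    (p : Polynomial ℂ)
    (h : i = j → (∀ q, τ (u * evalVar j q) = 0) ∨ (∀ q, τ (evalVar j q * v) = 0)) :
    tensorSquare τ ((u ⊗ₜ 1) * (differenceQuotient i (evalVar j p) * (1 ⊗ₜ v))) = 0 := by
  by_cases hij : i = j
  · subst hij
    have hmem := differenceQuotient_evalVar_mem i p
    generalize differenceQuotient i (evalVar i p) = z at hmem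
    induction hmem using Submodule.span_induction with
    | zero => simp
    | add x y _ _ hx hy => rw [add_mul, mul_add, map_add, hx, hy, add_zero]
    | smul c x _ hx => rw [smul_mul_assoc, mul_smul_comm, map_smul, hx, smul_zero]
    | mem x hx =>
      obtain ⟨q, r, rfl⟩ := hx
      simp only [Algebra.TensorProduct.tmul_mul_tmul, one_mul, mul_one, tensorSquare_tmul]
      rcases h rfl with h | h
      · rw [h, zero_mul]
      · rw [h, mul_zero]
  · rw [differenceQuotient_evalVar_of_ne hij]
    simp

/-- Differentiating a block other than the first leaves in the left leg a nonempty alternating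
product times a polynomial in the next variable, on which `τ` vanishes. -/
theorem VarsFree.tensorSquare_differenceQuotient_tail (hf : VarsFree τ) (h1 : τ 1 = 1) (i : ι)
    (l u : List (ι × Polynomial ℂ)) (hu : u ≠ []) (h : IsAlternatingCentered τ (u ++ l)) :
    tensorSquare τ ((blockProd u ⊗ₜ 1) * differenceQuotient i (blockProd l)) = 0 := by
  induction l generalizing u with
  | nil => simp [differenceQuotient_one]
  | cons a l ih =>
    have hsplit := List.isChain_append.1 h.1
    have hu' : IsAlternatingCentered τ u :=
      ⟨hsplit.1, fun b hb => h.2 b (List.mem_append_left _ hb)⟩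
    rw [blockProd_cons, differenceQuotient_mul, mul_add, map_add,
      tensorSquare_sandwich_differenceQuotient, zero_add]
    · have := ih (u ++ [a]) (by simp) (by simpa using h)
      rw [← mul_assoc, Algebra.TensorProduct.tmul_mul_tmul, one_mul]
      simpa using this
    · exact fun _ => Or.inl (hf.map_blockProd_mul h1 hu' hu
        fun b hb => hsplit.2.2 b hb a (by simp))

theorem schwingerDyson_evalVar
    (hmom : ∀ i n, τ (FreeAlgebra.ι ℂ i ^ (n + 1)) = ∑ k ∈ Finset.range n,
      τ (FreeAlgebra.ι ℂ i ^ k) * τ (FreeAlgebra.ι ℂ i ^ (n - 1 - k)))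
    (i : ι) (p : Polynomial ℂ) : τ (FreeAlgebra.ι ℂ i * evalVar i p)
      = tensorSquare τ (differenceQuotient i (evalVar i p)) := by
  induction p using Polynomial.induction_on' with
  | add p q hp hq => rw [map_add, mul_add, map_add, hp, hq, map_add, map_add]
  | monomial n c =>
    rw [← Polynomial.smul_X_eq_monomial, map_smul, map_smul, mul_smul_comm, map_smul, map_smul,
      map_pow, evalVar, Polynomial.aeval_X, differenceQuotient_ι_pow, if_pos rfl, ← pow_succ',
      hmom, map_sum]
    simp only [tensorSquare_tmul]

/-- By linearity `p` may be an alternating centered product, and only the derivative of its first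
block can contribute. Both sides vanish unless `p` is a single block in `xᵢ`, where the moment
recursion applies. -/
theorem VarsFree.schwingerDyson (hf : VarsFree τ) (h1 : τ 1 = 1)
    (hmom : ∀ i n, τ (FreeAlgebra.ι ℂ i ^ (n + 1)) = ∑ k ∈ Finset.range n,
      τ (FreeAlgebra.ι ℂ i ^ k) * τ (FreeAlgebra.ι ℂ i ^ (n - 1 - k)))
    (i : ι) (p : FreeAlgebra ℂ ι) :
    τ (FreeAlgebra.ι ℂ i * p) = tensorSquare τ (differenceQuotient i p) := by
  have h0 : ∀ i, τ (FreeAlgebra.ι ℂ i) = 0 := fun i => by simpa using hmom i 0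
  have hp : p ∈ Submodule.span ℂ {p | ∃ l, IsAlternatingCentered τ l ∧ blockProd l = p} := by
    rw [span_blockProd_eq_top h1 h0]; trivial
  induction hp using Submodule.span_induction with
  | zero => simp
  | add x y _ _ hx hy => rw [mul_add, map_add, hx, hy, map_add, map_add]
  | smul c x _ hx => rw [mul_smul_comm, map_smul, hx, map_smul, map_smul]
  | mem x hx =>
    obtain ⟨l, hl, rfl⟩ := hx
    have hX : FreeAlgebra.ι ℂ i = evalVar i Polynomial.X := by simp [evalVar]
    rcases l with _ | ⟨⟨j, q⟩, l⟩
    · simp [h0, differenceQuotient_one]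
    · have htail := hf.tensorSquare_differenceQuotient_tail h1 i l [(j, q)] (by simp)
        (by simpa using hl)
      rw [blockProd_cons, blockProd_nil, mul_one] at htail
      rw [blockProd_cons, differenceQuotient_mul, map_add, htail, add_zero]
      dsimp only
      by_cases hij : i = j
      · subst hij
        by_cases hne : l = []
        · subst hne
          simpa [← Algebra.TensorProduct.one_def] using schwingerDyson_evalVar hmom i q
        · rw [← mul_assoc, hX, ← map_mul, hf.map_mul_blockProd h1 hl.tail hne hl.head_ne]
          have := tensorSquare_sandwich_differenceQuotient (τ := τ) (i := i) (j := i) (u := 1)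
            (v := blockProd l) q
            fun _ => Or.inr (hf.map_mul_blockProd h1 hl.tail hne hl.head_ne)
          rw [← Algebra.TensorProduct.one_def, one_mul] at this
          exact this.symm
      · have := hf ((i, Polynomial.X) :: (j, q) :: l) (by simp)
          (hl.cons (by simp [evalVar, h0]) (by simpa using hij))
        rw [differenceQuotient_evalVar_of_ne hij, zero_mul, map_zero, ← this]
        simp [evalVar]

end SchwingerDyson

end FreeProb

/-! ### Recursions on words -/

namespace FreeProb

open scoped TensorProduct

section Words

/-- The sum `∑ B a b f(u) f(v)` over all splittings `w = u b v`, with `pre` prepended to `u`. -/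
def splitSum {α : Type*} (B : α → α → ℂ) (f : List α → ℂ) (a : α) : List α → List α → ℂ
  | _, [] => 0
  | pre, b :: w => B a b * (f pre * f w) + splitSum B f a (pre ++ [b]) w

/-- The moments of a word in the free algebra elements `Y a = ∑ₗ y a l xₗ` obey the
Schwinger–Dyson recursion with covariance `B a b = ∑ₗ y a l * y b l`. -/
theorem splitSum_of_schwingerDyson {ι α : Type*} [Fintype ι] [DecidableEq ι]
    {τ : FreeAlgebra ℂ ι →ₗ[ℂ] ℂ}
    (hSD : ∀ i p, τ (FreeAlgebra.ι ℂ i * p) = tensorSquare τ (differenceQuotient i p))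
    (y : α → ι → ℂ) (Y : α → FreeAlgebra ℂ ι) (hY : ∀ a, Y a = ∑ l, y a l • FreeAlgebra.ι ℂ l)
    (B : α → α → ℂ) (hB : ∀ a b, B a b = ∑ l, y a l * y b l) (a : α) (w : List α) :
    τ (((a :: w).map Y).prod) = splitSum B (fun w => τ ((w.map Y).prod)) a [] w := by
  -- The derivation in direction `Y a` sends each letter `Y b` to the scalar `B a b`, so `D` of a
  -- word is a sum over its splittings.
  set D : FreeAlgebra ℂ ι →ₗ[ℂ] FreeAlgebra ℂ ι ⊗[ℂ] FreeAlgebra ℂ ι :=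
    ∑ l, y a l • differenceQuotient l with hD
  have hDmul : ∀ p q, D (p * q) = D p * (1 ⊗ₜ q) + (p ⊗ₜ 1) * D q := by
    intro p q
    simp only [hD, LinearMap.sum_apply, LinearMap.smul_apply, differenceQuotient_mul, smul_add,
      Finset.sum_add_distrib, Finset.sum_mul, Finset.mul_sum, smul_mul_assoc, mul_smul_comm]
  have hD1 : D 1 = 0 := by simp [hD, differenceQuotient_one]
  have hDY : ∀ b, D (Y b) = B a b • 1 := by
    intro b
    simp [hD, hY, hB, differenceQuotient_ι, Finset.sum_smul, smul_smul, mul_comm]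
  have hD2 : τ (((a :: w).map Y).prod) = tensorSquare τ (D (w.map Y).prod) := by
    simp [hD, hY a, Finset.sum_mul, hSD]
  have key : ∀ w u : List α,
      tensorSquare τ (((u.map Y).prod ⊗ₜ 1) * D (w.map Y).prod)
        = splitSum B (fun w => τ ((w.map Y).prod)) a u w := by
    intro w
    induction w with
    | nil => intro u; simp [splitSum, hD1]
    | cons b w ih =>
      intro u
      rw [splitSum, ← ih (u ++ [b]), List.map_cons, List.prod_cons, hDmul, mul_add, map_add, hDY]
      congr 1
      · rw [smul_mul_assoc, one_mul, mul_smul_comm, map_smul,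
          Algebra.TensorProduct.tmul_mul_tmul, mul_one, one_mul, tensorSquare_tmul, smul_eq_mul]
      · rw [← mul_assoc, Algebra.TensorProduct.tmul_mul_tmul]
        simp
  rw [hD2, ← key w []]
  simp [← Algebra.TensorProduct.one_def]

/-- The word in `cᵢ⋆` and `cᵢ` with alternating stars; `true` stands for a starred letter. -/
def alternate {α : Type*} : Bool → List α → List (α × Bool)
  | _, [] => []
  | b, i :: w => (i, b) :: alternate (!b) w

@[simp] theorem alternate_nil {α : Type*} (b : Bool) : alternate b ([] : List α) = [] := rfl

@[simp] theorem alternate_cons {α : Type*} (b : Bool) (i : α) (w : List α) :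
    alternate b (i :: w) = (i, b) :: alternate (!b) w := rfl

theorem alternate_append_singleton {α : Type*} (b : Bool) (u : List α) (j : α) :
    alternate b (u ++ [j]) = alternate b u ++ [(j, if Even u.length then b else !b)] := by
  induction u generalizing b with
  | nil => simp
  | cons i u ih =>
    simp only [List.cons_append, alternate_cons, ih, List.length_cons, Nat.even_add_one]
    by_cases h : Even u.length <;> simp [h]

/-- The covariance of a semicircular system. -/
def semicircularCov {α : Type*} [DecidableEq α] (i j : α) : ℂ := if i = j then 1 else 0

/-- The covariance of a circular system, with letters `(i, true)` for `cᵢ⋆` and `(i, false)` for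
`cᵢ`. -/
def circularCov {α : Type*} [DecidableEq α] (a b : α × Bool) : ℂ :=
  if a.1 = b.1 ∧ b.2 = !a.2 then 1 else 0

variable {α : Type*} {f : List α → ℂ} {g : List (α × Bool) → ℂ}

/-- Removing the paired letter leaves two words of odd total length, one of which is odd. -/
theorem splitSum_eq_zero_of_odd {B : α → α → ℂ} (a : α) (n : ℕ)
    (hodd : ∀ w, w.length ≤ n → Odd w.length → f w = 0) (w : List α) :
    ∀ u : List α, u.length + w.length ≤ n + 1 → Even (u.length + w.length) →
      splitSum B f a u w = 0 := by
  induction w with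
  | nil => intro u _ _; rfl
  | cons b w ih =>
    intro u hn he
    rw [List.length_cons] at hn he
    rw [splitSum, ih (u ++ [b]) (by simp; omega) (by simpa [add_assoc, add_comm 1] using he),
      add_zero]
    rcases Nat.even_or_odd u.length with hu | hu
    · rw [hodd w (by omega) (by rw [Nat.odd_iff]; rw [Nat.even_iff] at he hu; omega), mul_zero,
        mul_zero]
    · rw [hodd u (by omega) hu, zero_mul, mul_zero]

theorem eq_zero_of_odd_length {B : α → α → ℂ} (hf : ∀ a w, f (a :: w) = splitSum B f a [] w)
    (n : ℕ) : ∀ w, w.length ≤ n → Odd w.length → f w = 0 := by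
  induction n with
  | zero =>
    intro w h ho
    rw [Nat.le_zero.1 h] at ho
    simp at ho
  | succ n ih =>
    intro w h ho
    rcases w with _ | ⟨a, w⟩
    · simp at ho
    · rw [List.length_cons] at h ho
      rw [hf]
      refine splitSum_eq_zero_of_odd a n ih w [] (by simp; omega) ?_
      rw [Nat.even_iff]; rw [Nat.odd_iff] at ho; simp; omega

/-- The sums agree term by term. After a prefix of even length the letter carries the opposite star,
so the covariances coincide. After an odd prefix the semicircular term dies because `f u = 0`, the
circular one because the stars coincide. -/
theorem splitSum_semicircular_eq_circular [DecidableEq α] (i : α) (b : Bool) (n : ℕ)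
    (hodd : ∀ w, Odd w.length → f w = 0)
    (heven : ∀ w b, w.length ≤ n → Even w.length → f w = g (alternate b w)) (w : List α) :
    ∀ u : List α, u.length + w.length ≤ n + 1 → Odd (u.length + w.length) →
      splitSum semicircularCov f i u w = splitSum circularCov g (i, b) (alternate (!b) u)
        (alternate (if Even u.length then !b else b) w) := by
  induction w with
  | nil => intro u _ _; rfl
  | cons j w ih =>
    intro u hn ho
    rw [List.length_cons] at hn ho
    rw [alternate_cons, splitSum, splitSum, ih (u ++ [j]) (by simp; omega)
      (by simpa [add_assoc, add_comm 1] using ho), alternate_append_singleton]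
    rcases Nat.even_or_odd u.length with hu | hu
    · have hw : Even w.length := by rw [Nat.even_iff] at hu ⊢; rw [Nat.odd_iff] at ho; omega
      rw [heven u (!b) (by omega) hu, heven w b (by omega) hw]
      simp [hu, semicircularCov, circularCov, Nat.even_add_one]
    · have hu' : ¬ Even u.length := Nat.not_even_iff_odd.2 hu
      rw [hodd u hu]
      simp [hu', circularCov, Nat.even_add_one]

/-- Moments of even words of a semicircular system agree with those of the alternating words of
a circular system. -/
theorem eq_alternate_of_even_length [DecidableEq α] (hf0 : f [] = 1) (hg0 : g [] = 1)
    (hf : ∀ a w, f (a :: w) = splitSum semicircularCov f a [] w)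
    (hg : ∀ a w, g (a :: w) = splitSum circularCov g a [] w) (n : ℕ) :
    ∀ w b, w.length ≤ n → Even w.length → f w = g (alternate b w) := by
  induction n with
  | zero =>
    intro w b h _
    rw [List.eq_nil_of_length_eq_zero (Nat.le_zero.1 h), alternate_nil, hf0, hg0]
  | succ n ih =>
    intro w b h he
    rcases w with _ | ⟨i, w⟩
    · rw [alternate_nil, hf0, hg0]
    · rw [List.length_cons] at h he
      rw [hf, alternate_cons, hg]
      refine splitSum_semicircular_eq_circular i b n
        (fun w => eq_zero_of_odd_length hf w.length w le_rfl) ih w [] (by simp; omega) ?_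
      rw [Nat.odd_iff]; rw [Nat.even_iff] at he; simp; omega

end Words

/-! ### Semicircular and circular systems -/

section Systems

variable {𝒜 : Type*} [CStarAlgebra 𝒜] {φ : 𝒜 →ₗ[ℂ] ℂ} {ι : Type*} {s : ι → 𝒜}

/-- The functional on the free algebra induced by a family of elements. -/
noncomputable def pullback (φ : 𝒜 →ₗ[ℂ] ℂ) (s : ι → 𝒜) : FreeAlgebra ℂ ι →ₗ[ℂ] ℂ :=
  φ ∘ₗ (FreeAlgebra.lift ℂ s).toLinearMap

theorem pullback_apply (p : FreeAlgebra ℂ ι) : pullback φ s p = φ (FreeAlgebra.lift ℂ s p) := rfl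

theorem lift_evalVar (i : ι) (p : Polynomial ℂ) :
    FreeAlgebra.lift ℂ s (evalVar i p) = Polynomial.aeval (s i) p := by
  rw [evalVar, ← Polynomial.aeval_algHom_apply, FreeAlgebra.lift_ι_apply]

theorem FreeFamily.varsFree (hs : FreeFamily φ s) : VarsFree (pullback φ s) := by
  intro l hne hl
  have h := hs (l.map fun a => (a.1, Polynomial.aeval (s a.1) a.2)) (by simpa using hne)
    (by rw [List.isChain_map]; exact hl.1) (by
      intro p hp
      obtain ⟨a, ha, rfl⟩ := List.mem_map.1 hp
      refine ⟨?_, ?_⟩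
      · have hmem : Polynomial.aeval (s a.1) a.2 ∈ Algebra.adjoin ℂ {s a.1} :=
          Polynomial.aeval_mem_adjoin_singleton ℂ (s a.1)
        have hle : Algebra.adjoin ℂ {s a.1} ≤ (StarAlgebra.adjoin ℂ {s a.1}).toSubalgebra :=
          Algebra.adjoin_le (StarAlgebra.subset_adjoin ℂ {s a.1})
        exact hle hmem
      · have := hl.2 a ha
        rwa [pullback_apply, lift_evalVar] at this)
  rw [pullback_apply, blockProd, map_list_prod]
  simpa [Function.comp_def, lift_evalVar] using h

theorem IsSemicircularSystem.schwingerDyson [DecidableEq ι] (hφ : IsTracialFaithfulState φ)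
    (hs : IsSemicircularSystem φ s) (i : ι) (p : FreeAlgebra ℂ ι) :
    pullback φ s (FreeAlgebra.ι ℂ i * p)
      = tensorSquare (pullback φ s) (differenceQuotient i p) := by
  refine hs.1.varsFree.schwingerDyson (by simp [pullback_apply, hφ.map_one]) (fun i n => ?_) i p
  obtain ⟨-, hprob, hmom⟩ := hs.2 i
  simp only [pullback_apply, map_pow, FreeAlgebra.lift_ι_apply, (hmom _).2,
    semicircleLaw_moment_succ hprob]
  push_cast
  rfl

/-- Schwinger–Dyson recursion for linear combinations of a semicircular system. -/
theorem IsSemicircularSystem.map_prod_eq_splitSum [Fintype ι] (hφ : IsTracialFaithfulState φ)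
    (hs : IsSemicircularSystem φ s) {α : Type*} (y : α → ι → ℂ) (x : α → 𝒜)
    (hx : ∀ a, x a = ∑ l, y a l • s l) (B : α → α → ℂ) (hB : ∀ a b, B a b = ∑ l, y a l * y b l)
    (a : α) (w : List α) :
    φ (((a :: w).map x).prod) = splitSum B (fun w => φ ((w.map x).prod)) a [] w := by
  classical
  have h := splitSum_of_schwingerDyson (hs.schwingerDyson hφ) y
    (fun a => ∑ l, y a l • FreeAlgebra.ι ℂ l) (fun _ => rfl) B hB a w
  have hlift : ∀ w : List α, pullback φ s
      ((w.map fun a => ∑ l, y a l • FreeAlgebra.ι ℂ l).prod) = φ ((w.map x).prod) := by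
    intro w
    rw [pullback_apply, map_list_prod, List.map_map]
    congr 3
    funext a
    simp [hx]
  simpa only [hlift] using h

theorem IsSemicircularSystem.map_prod_cons [Fintype ι] [DecidableEq ι]
    (hφ : IsTracialFaithfulState φ) (hs : IsSemicircularSystem φ s) (a : ι) (w : List ι) :
    φ (((a :: w).map s).prod)
      = splitSum semicircularCov (fun w => φ ((w.map s).prod)) a [] w :=
  hs.map_prod_eq_splitSum hφ (fun a l => if a = l then 1 else 0) s (fun a => by simp) _
    (fun a b => by simp [semicircularCov]) a w

/-- The letter `cᵢ⋆` or `cᵢ`. -/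
def starLetter (c : ι → 𝒜) (a : ι × Bool) : 𝒜 := if a.2 then star (c a.1) else c a.1

/-- The covariance is bilinear in the coefficients, without conjugation: equal stars give `1/2 - 1/2
= 0`, opposite stars `1/2 + 1/2 = 1`. -/
theorem IsCircularSystem.map_prod_cons [Fintype ι] [DecidableEq ι] {c : ι → 𝒜}
    (hφ : IsTracialFaithfulState φ) (hc : IsCircularSystem φ c) (a : ι × Bool)
    (w : List (ι × Bool)) : φ (((a :: w).map (starLetter c)).prod)
      = splitSum circularCov (fun w => φ ((w.map (starLetter c)).prod)) a [] w := by
  obtain ⟨t, t', ht, hct⟩ := hc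
  have hst : ∀ i, star (t i) = t i := fun i => (ht.2 (Sum.inl i)).1
  have hst' : ∀ i, star (t' i) = t' i := fun i => (ht.2 (Sum.inr i)).1
  have h2 : ((Real.sqrt 2 : ℝ) : ℂ)⁻¹ * ((Real.sqrt 2 : ℝ) : ℂ)⁻¹ = 1 / 2 := by
    rw [← mul_inv, ← Complex.ofReal_mul, Real.mul_self_sqrt (by norm_num)]
    norm_num
  have h3 : ((Real.sqrt 2 : ℝ) : ℂ)⁻¹ * Complex.I * (((Real.sqrt 2 : ℝ) : ℂ)⁻¹ * Complex.I)
      = -(1 / 2) := by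
    linear_combination Complex.I * Complex.I * h2 + 1 / 2 * Complex.I_mul_I
  refine ht.map_prod_eq_splitSum hφ (fun a => Sum.elim
    (fun l => if a.1 = l then ((Real.sqrt 2 : ℝ) : ℂ)⁻¹ else 0)
    (fun l => if a.1 = l then ((Real.sqrt 2 : ℝ) : ℂ)⁻¹ * (if a.2 then -Complex.I else Complex.I)
      else 0)) _ (fun a => ?_) _ (fun a b => ?_) a w
  · obtain ⟨i, b⟩ := a
    cases b <;>
      simp [starLetter, hct, hst, hst', smul_smul]
  · obtain ⟨i, d⟩ := a
    obtain ⟨j, d'⟩ := b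
    by_cases hij : i = j
    · subst hij
      cases d <;> cases d' <;> simp [circularCov, h2, h3] <;> norm_num
    · simp [circularCov, hij]

end Systems

/-! ### Joint moments of the quadratic words -/

section Quadratic

variable {𝒜 ℬ : Type*} [CStarAlgebra 𝒜] [CStarAlgebra ℬ] {φ : 𝒜 →ₗ[ℂ] ℂ} {ψ : ℬ →ₗ[ℂ] ℂ}
  {ι : Type*}

theorem list_prod_pairs (s : ι → 𝒜) (w : List (ι × ι)) :
    (w.map fun e => s e.1 * s e.2).prod = ((w.flatMap fun e => [e.1, e.2]).map s).prod := by
  induction w with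
  | nil => simp
  | cons e w ih => simp [ih, mul_assoc]

theorem list_prod_star_pairs (c : ι → ℬ) (w : List (ι × ι)) :
    (w.map fun e => star (c e.1) * c e.2).prod
      = ((alternate true (w.flatMap fun e => [e.1, e.2])).map (starLetter c)).prod := by
  induction w with
  | nil => simp
  | cons e w ih => simp [ih, mul_assoc, starLetter]

theorem even_length_flatMap_pairs (w : List (ι × ι)) :
    Even (w.flatMap fun e => [e.1, e.2]).length := by
  induction w with
  | nil => simp
  | cons e w ih => simp [Nat.even_add_one]

/-- On a monomial, the products `s i * s j` concatenate to a word of even length, and the products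
`star (c i) * c j` to its alternating version starting with a star. -/
theorem map_lift_pairs_eq [Fintype ι] (hφ : IsTracialFaithfulState φ)
    (hψ : IsTracialFaithfulState ψ) {s : ι → 𝒜} (hs : IsSemicircularSystem φ s) {c : ι → ℬ}
    (hc : IsCircularSystem ψ c) (p : FreeAlgebra ℂ (ι × ι)) :
    φ (FreeAlgebra.lift ℂ (fun e : ι × ι => s e.1 * s e.2) p)
      = ψ (FreeAlgebra.lift ℂ (fun e : ι × ι => star (c e.1) * c e.2) p) := by
  classical
  have hp : p ∈ Submodule.span ℂ
      {p | ∃ w : List (ι × ι), (w.map (FreeAlgebra.ι ℂ)).prod = p} := by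
    rw [freeAlgebra_submodule_eq_top (Submodule.span ℂ
      {p | ∃ w : List (ι × ι), (w.map (FreeAlgebra.ι ℂ)).prod = p})
      (Submodule.subset_span ⟨[], rfl⟩)]
    · trivial
    intro e q hq
    induction hq using Submodule.span_induction with
    | zero => simp
    | add x y _ _ hx hy => rw [mul_add]; exact Submodule.add_mem _ hx hy
    | smul r x _ hx => rw [mul_smul_comm]; exact Submodule.smul_mem _ _ hx
    | mem x hx =>
      obtain ⟨w, rfl⟩ := hx
      exact Submodule.subset_span ⟨e :: w, by simp⟩
  induction hp using Submodule.span_induction with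
  | zero => simp
  | add x y _ _ hx hy => simp only [map_add, hx, hy]
  | smul r x _ hx => simp only [map_smul, hx]
  | mem x hx =>
    obtain ⟨w, rfl⟩ := hx
    have h := eq_alternate_of_even_length (f := fun w => φ ((w.map s).prod))
      (g := fun w => ψ ((w.map (starLetter c)).prod)) (by simp [hφ.map_one])
      (by simp [hψ.map_one]) (hs.map_prod_cons hφ) (hc.map_prod_cons hψ) _ _ true le_rfl
      (even_length_flatMap_pairs w)
    rw [← list_prod_pairs, ← list_prod_star_pairs] at h
    simpa [map_list_prod, Function.comp_def] using h

end Quadratic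

end FreeProb

theorem proposition2p3 {𝒜 ℬ : Type*} [CStarAlgebra 𝒜] [CStarAlgebra ℬ]
    (φ : 𝒜 →ₗ[ℂ] ℂ) (hφ : FreeProb.IsTracialFaithfulState φ)
    (ψ : ℬ →ₗ[ℂ] ℂ) (hψ : FreeProb.IsTracialFaithfulState ψ)
    (k : ℕ) (s : Fin k → 𝒜) (hs : FreeProb.IsSemicircularSystem φ s)
    (c : Fin k → ℬ) (hc : FreeProb.IsCircularSystem ψ c)
    (A : Matrix (Fin k) (Fin k) ℂ) :
    ‖∑ i, ∑ j, A i j • (s i * s j)‖ = ‖∑ i, ∑ j, A i j • (star (c i) * c j)‖ := by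
  have hsa : ∀ i, star (s i) = s i := fun i => (hs.2 i).1
  refine FreeProb.norm_eq_of_moments_eq hφ hψ _ _ fun n => ?_
  -- Taking adjoints swaps the indices in both families, since `s j * s i` and `star (c j) * c i`
  -- are the adjoints. Hence one noncommutative polynomial represents `(star X * X) ^ n` on both
  -- sides.
  have h := FreeProb.map_lift_pairs_eq hφ hψ hs hc
    (((∑ i, ∑ j, star (A i j) • FreeAlgebra.ι ℂ (j, i)) *
      ∑ i, ∑ j, A i j • FreeAlgebra.ι ℂ (i, j)) ^ n)
  simpa [star_sum, hsa] using h
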